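/- Let $(m_i)_{i\ge 1}$ be a sequence of integers with $m_i\ge 2$, let $\Omega_i=\mathbb Z/m_i\mathbb Z$, and let $\Omega=\prod_{i\ge 1}\Omega_i$. For each $i$ let $\mu_i$ be a probability measure on $\Omega_i$ with $\mu_i(j):=\mu_i(\{j\})>0$ for all $j\in\Omega_i$, and let $\mu=\bigotimes_{i\ge 1}\mu_i$ be the product measure on $\Omega$. Assume that $$\prod_{i=1}^{\infty}\ \sup_{j\in\Omega_i}\frac{\mu_i(j-1)}{\mu_i(j)}<\infty .$$ Let $1\le p<\infty$, let $L_p(\Omega,\mu)$ be the space of complex-valued $L_p$-functions, let $\mathfrak t:\Omega\to\Omega$ be the diagonal translation $\mathfrak t(x)=(x_i+1)_{i\ge 1}$, and let $C_{\mathfrak t}f=f\circ\mathfrak t$. Let $(d_i)_{i\ge 1}$ be a nondecreasing sequence of positive integers such that $d_i$ is a multiple of $m_1,\dots,m_i$ for every $i$. Assume that there exists $\kappa>0$ such that for every $\varepsilon>0$ and every $i_0\in\mathbb N$ there exist $i\ge i_0$, an integer $n\ge 0$ and a set $D\subset\Omega_i$ such that, for all integers $k$ with $0\le k\le\kappa d_i$,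 $$\mu_i(D-k)\le\varepsilon\qquad\text{and}\qquad \mu_i\bigl(D-(n+k)\bigr)\ge 1-\varepsilon .$$ Then $\mathfrak t$ is nonsingular with respect to $\mu$ (so that $C_{\mathfrak t}$ is well defined on almost-everywhere classes), $C_{\mathfrak t}$ is a bounded operator on $L_p(\Omega,\mu)$, and $C_{\mathfrak t}$ is frequently hypercyclic: there exists $f\in L_p(\Omega,\mu)$ such that, for every nonempty open set $V\subset L_p(\Omega,\mu)$, the set $\{n\ge 1: C_{\mathfrak t}^n f\in V\}$ has positive lower density. -/

import Mathlib

open MeasureTheory Filter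

noncomputable section

/-- The lower (asymptotic) density of a set of positive integers. -/
def lowerDensity (A : Set ℕ) : ℝ :=
  liminf (fun N : ℕ => ((A ∩ Set.Icc 1 N).ncard : ℝ) / (N : ℝ)) atTop

/-- A bounded operator is frequently hypercyclic if the orbit of some vector visits every nonempty
open set along a set of times of positive lower density. -/
def IsFrequentlyHypercyclic {X : Type*} [NormedAddCommGroup X] [NormedSpace ℂ X]
    (T : X →L[ℂ] X) : Prop :=
  ∃ x : X, ∀ V : Set X, IsOpen V → V.Nonempty → 0 < lowerDensity {n : ℕ | (T ^ n) x ∈ V}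

/-- `T` is the composition operator `f ↦ f ∘ φ` acting (boundedly) on `L_p(μ)`, where `φ` is
measurable and nonsingular, so that `f ∘ φ` is well defined up to almost everywhere equality. -/
structure IsCompositionOperator {Ω : Type*} [MeasurableSpace Ω] (φ : Ω → Ω) (μ : Measure Ω)
    (p : ENNReal) [Fact (1 ≤ p)] (T : Lp ℂ p μ →L[ℂ] Lp ℂ p μ) : Prop where
  nonsingular : Measure.QuasiMeasurePreserving φ μ μ
  apply_ae_eq : ∀ f : Lp ℂ p μ, ⇑(T f) =ᵐ[μ] ⇑f ∘ φ

/-- The diagonal translation `x ↦ (x_i + 1)_i` of the product of the groups `ℤ/m_iℤ`. -/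
def diagonalTranslation (m : ℕ → ℕ) (x : ∀ i, ZMod (m i)) : ∀ i, ZMod (m i) :=
  fun i => x i + 1

/-- The translate `D - k` of a set `D ⊆ ℤ/mℤ`. -/
def translateSub {m : ℕ} (D : Set (ZMod m)) (k : ℕ) : Set (ZMod m) :=
  (fun x => x - (k : ZMod m)) '' D

/-- The maximal ratio `sup_j μ({j - 1}) / μ({j})` over `j ∈ ℤ/mℤ`. -/
def maxShiftRatio {m : ℕ} (μ : Measure (ZMod m)) : ℝ :=
  ⨆ j : ZMod m, μ.real {j - 1} / μ.real {j}

end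

/-! Functions of finitely many coordinates are dense in $L_p$, and each is periodic under
$C_{\mathfrak t}$. The separation hypothesis glues two of them, $u$ and $w$, into a third: take $u$
off $\{x_i\in D\}$ and a translate of $w$ on it, with $i$ large. The orbit of the result stays close
to that of $u$ on $[0,K]$ and to that of $w$ on $[n,n+K]$, and it has a period at most $qK$ with $q$
fixed (`exists_mem_cylinderClasses_shadow`).

Iterating this gives periodic points $u_j$: each $u_{j+1}$ follows $u_j$ for longer than the
recorded period of $u_j$, then follows a target from a dense sequence. A step divides the visiting
frequency of older targets by at most $2q$. Since every target is served again after a bounded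
number of steps, its frequency along the $u_j$ stays bounded below, and $x=\lim u_j$ inherits this
(`exists_frequently_visiting`).

Boundedness of $C_{\mathfrak t}$ comes from comparing $\mu$ with its image on cylinders
(`map_diagonalTranslation_le`). -/

/-! ### Visiting frequencies and the specification criterion -/

theorem le_mul_count_of_dvd {p : ℕ} (hp : 0 < p) {P : ℕ → Prop} [DecidablePred P]
    (hP : ∀ k, p ∣ k → P k) (K : ℕ) : K ≤ p * Nat.count P K := by
  induction K using Nat.strong_induction_on generalizing P with
  | _ K ih =>
    rcases Nat.eq_zero_or_pos K with rfl | hK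
    · simp
    have h1 : 0 < Nat.count P 1 := by simp [Nat.count_succ, hP 0 (dvd_zero p)]
    rcases le_total K p with h | h
    · have h2 : Nat.count P 1 ≤ Nat.count P K := Nat.count_monotone P hK
      nlinarith
    · obtain ⟨K', rfl⟩ := Nat.exists_eq_add_of_le h
      have h2 : Nat.count P 1 ≤ Nat.count P p := Nat.count_monotone P hp
      have h3 := ih K' (by omega) (P := fun k => P (p + k))
        (fun k hk => hP _ ((Nat.dvd_add_right (dvd_refl p)).2 hk))
      rw [Nat.count_add]
      nlinarith

theorem count_mul_of_periodic {P : ℕ → Prop} [DecidablePred P] {d : ℕ}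
    (hP : ∀ k, P (d + k) ↔ P k) (a : ℕ) : Nat.count P (a * d) = a * Nat.count P d := by
  induction a with
  | zero => simp
  | succ a ih =>
    rw [Nat.succ_mul, Nat.add_comm, Nat.count_add]
    simp only [hP, ih]
    ring

-- Each full period of `v` contains a copy of the first `K` steps of `u`, and `K ≥ d / q`. The
-- factor 2 pays for the incomplete last period, as `N ≤ 2 * d * (N / d)` when `N ≥ d`.
open Classical in
theorem le_mul_count_of_shadow {X : Type*} [PseudoMetricSpace X] {T : X → X} {u v y : X}
    {d K n q Q : ℕ} {r ε : ℝ} (hK : 0 < K) (hnK : n + K ≤ d) (hdK : d ≤ q * K)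
    (hv : T^[d] v = v) (hsh : ∀ k ≤ K, dist (T^[n + k] v) (T^[k] u) ≤ ε)
    (hu : K ≤ Q * Nat.count (fun k => dist (T^[k] u) y ≤ r) K) (N : ℕ) (hN : d ≤ N) :
    N ≤ 2 * q * Q * Nat.count (fun k => dist (T^[k] v) y ≤ r + ε) N := by
  set P : ℕ → Prop := fun k => dist (T^[k] v) y ≤ r + ε
  set P' : ℕ → Prop := fun k => dist (T^[k] u) y ≤ r
  have h1 : Nat.count P' K ≤ Nat.count P d := by
    calc Nat.count P' K ≤ Nat.count (fun k => P (n + k)) K := by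
          rw [Nat.count_eq_card_filter_range, Nat.count_eq_card_filter_range]
          refine Finset.card_le_card fun k hk => ?_
          simp only [Finset.mem_filter, Finset.mem_range] at hk ⊢
          refine ⟨hk.1, ?_⟩
          have h2 := hsh k hk.1.le
          have h3 := dist_triangle (T^[n + k] v) (T^[k] u) y
          have h4 : dist (T^[k] u) y ≤ r := hk.2
          change dist (T^[n + k] v) y ≤ r + ε
          linarith
      _ ≤ Nat.count P (n + K) := by rw [Nat.count_add]; omega
      _ ≤ Nat.count P d := Nat.count_monotone P hnK
  have h2 : N / d * Nat.count P d ≤ Nat.count P N := by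
    rw [← count_mul_of_periodic (P := P)]
    · exact Nat.count_monotone P (Nat.div_mul_le_self N d)
    · intro k
      change dist (T^[d + k] v) y ≤ r + ε ↔ dist (T^[k] v) y ≤ r + ε
      rw [add_comm, Function.iterate_add_apply, hv]
  have hd : 0 < d := by omega
  have h3 : 1 ≤ N / d := (Nat.one_le_div_iff hd).2 hN
  have h4 : N < d * (N / d + 1) := Nat.lt_mul_div_succ N hd
  calc N ≤ d * (N / d + 1) := h4.le
    _ ≤ d * (2 * (N / d)) := Nat.mul_le_mul_left _ (by omega)
    _ ≤ (q * K) * (2 * (N / d)) := Nat.mul_le_mul_right _ hdK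
    _ ≤ (q * (Q * Nat.count P' K)) * (2 * (N / d)) := by gcongr
    _ ≤ (q * (Q * Nat.count P d)) * (2 * (N / d)) := by gcongr
    _ = 2 * q * Q * (N / d * Nat.count P d) := by ring
    _ ≤ 2 * q * Q * Nat.count P N := by gcongr

/-- The 2-adic valuation takes each value with bounded gaps. -/
theorem exists_padicValNat_two_eq (L J : ℕ) :
    ∃ j, J ≤ j ∧ j ≤ J + 2 ^ (L + 2) ∧ padicValNat 2 (j + 1) = L := by
  set t := J / 2 ^ (L + 1) + 1
  have hp : 0 < 2 ^ (L + 1) := by positivity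
  have h1 := Nat.lt_mul_div_succ J hp
  have h2 := Nat.div_mul_le_self J (2 ^ (L + 1))
  have hL : 2 ^ (L + 1) = 2 * 2 ^ L := by ring
  have hL' : 2 ^ (L + 2) = 4 * 2 ^ L := by ring
  have hpos : 0 < 2 ^ L := by positivity
  have key : 2 ^ L * (2 * t + 1) = 2 ^ (L + 1) * (J / 2 ^ (L + 1)) + 3 * 2 ^ L := by
    simp only [t]; ring
  refine ⟨2 ^ L * (2 * t + 1) - 1, ?_, ?_, ?_⟩
  · rw [key]; rw [mul_add] at h1; omega
  · rw [key]; rw [mul_comm] at h2; omega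
  · rw [Nat.sub_add_cancel (by rw [key]; omega),
      padicValNat.mul (by positivity) (by positivity), padicValNat.prime_pow,
      padicValNat.eq_zero_of_not_dvd (by omega), add_zero]

/-- A specification-type criterion for the existence of a point whose orbit visits periodic points
frequently. -/
theorem exists_frequently_visiting {X : Type*} [MetricSpace X] [CompleteSpace X] {T : X → X}
    (hT : Continuous T) {S : Set X} {y : ℕ → X} (hyS : ∀ l, y l ∈ S)
    (hy : ∀ l, ∃ p, 0 < p ∧ T^[p] (y l) = y l) {q : ℕ}
    (H : ∀ u ∈ S, ∀ w ∈ S, ∀ ε : ℝ, 0 < ε → ∀ M : ℕ, ∃ v ∈ S, ∃ d K n : ℕ,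
      M ≤ K ∧ n + K ≤ d ∧ d ≤ q * K ∧ T^[d] v = v ∧
      (∀ k ≤ K, dist (T^[k] v) (T^[k] u) ≤ ε) ∧ ∀ k ≤ K, dist (T^[n + k] v) (T^[k] w) ≤ ε) :
    ∃ x, ∀ l, ∀ r : ℝ, 0 < r → ∃ Q : ℕ, 0 < Q ∧ ∀ᶠ N in atTop, ∀ A : Set ℕ,
      (∀ k, dist (T^[k] x) (y l) < r → k ∈ A) → N ≤ Q * ((A ∩ Set.Iio N).ncard) := by
  classical
  choose! fv hfvS fd fK fn hM hnK hdK hper hsh hhit using H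
  -- Schedule of targets: every index recurs with bounded gaps.
  let ℓ : ℕ → ℕ := fun j => padicValNat 2 (j + 1)
  -- The state is a point with its period. The bound `s.2 + 1` forces `d j < K j`, so the frequency
  -- estimate for `u j`, valid from time `d j` on, applies at time `K j`.
  let step : ℕ → X × ℕ → X × ℕ := fun j s =>
    (fv s.1 (y (ℓ j)) ((1 / 2) ^ j) (s.2 + 1), fd s.1 (y (ℓ j)) ((1 / 2) ^ j) (s.2 + 1))
  let σ : ℕ → X × ℕ := fun j => Nat.rec (y 0, 0) step j
  let u : ℕ → X := fun j => (σ j).1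
  let d : ℕ → ℕ := fun j => (σ j).2
  let K : ℕ → ℕ := fun j => fK (u j) (y (ℓ j)) ((1 / 2) ^ j) (d j + 1)
  let n : ℕ → ℕ := fun j => fn (u j) (y (ℓ j)) ((1 / 2) ^ j) (d j + 1)
  have hε : ∀ j : ℕ, (0 : ℝ) < (1 / 2) ^ j := fun j => by positivity
  have huS : ∀ j, u j ∈ S := by
    intro j
    induction j with
    | zero => exact hyS 0
    | succ j ih => exact hfvS _ ih _ (hyS _) _ (hε j) _
  have hM' : ∀ j, d j + 1 ≤ K j := fun j => hM _ (huS j) _ (hyS _) _ (hε j) _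
  have hnK' : ∀ j, n j + K j ≤ d (j + 1) := fun j => hnK _ (huS j) _ (hyS _) _ (hε j) _
  have hdK' : ∀ j, d (j + 1) ≤ q * K j := fun j => hdK _ (huS j) _ (hyS _) _ (hε j) _
  have hper' : ∀ j, T^[d (j + 1)] (u (j + 1)) = u (j + 1) :=
    fun j => hper _ (huS j) _ (hyS _) _ (hε j) _
  have hsh' : ∀ j, ∀ k ≤ K j, dist (T^[k] (u (j + 1))) (T^[k] (u j)) ≤ (1 / 2) ^ j :=
    fun j => hsh _ (huS j) _ (hyS _) _ (hε j) _
  have hhit' : ∀ j, ∀ k ≤ K j, dist (T^[n j + k] (u (j + 1))) (T^[k] (y (ℓ j))) ≤ (1 / 2) ^ j :=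
    fun j => hhit _ (huS j) _ (hyS _) _ (hε j) _
  clear_value n K
  have hd : StrictMono d := strictMono_nat_of_lt_succ fun j => by
    have := hM' j; have := hnK' j; omega
  have hK : Monotone K := monotone_nat_of_le_succ fun j => by
    have := hM' (j + 1); have := hnK' j; omega
  have hq : 0 < q := by
    rcases Nat.eq_zero_or_pos q with h | h
    · have h1 := hdK' 0
      have h2 := hnK' 0
      have h3 := hM' 0
      rw [h, zero_mul] at h1
      omega
    · exact h
  have hgeo : ∀ i, dist (u i) (u (i + 1)) ≤ 2 / 2 / 2 ^ i := by
    intro i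
    have := hsh' i 0 (Nat.zero_le _)
    rw [dist_comm]
    simpa using this
  obtain ⟨x, hx⟩ := cauchySeq_tendsto_of_complete (cauchySeq_of_le_geometric_two hgeo)
  have hxu : ∀ j, ∀ k ≤ K j, dist (T^[k] x) (T^[k] (u j)) ≤ 2 * (1 / 2) ^ j := by
    intro j k hk
    have h1 : Tendsto (fun i => T^[k] (u (j + i))) atTop (nhds (T^[k] x)) :=
      ((hT.iterate k).tendsto x).comp (by simpa [add_comm] using (tendsto_add_atTop_iff_nat j).2 hx)
    have h2 := dist_le_of_le_geometric_two_of_tendsto₀ (C := 2 * (1 / 2) ^ j)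
      (f := fun i => T^[k] (u (j + i))) (a := T^[k] x) (fun i => ?_) h1
    · rw [dist_comm]; simpa using h2
    · rw [dist_comm]
      have h3 := hsh' (j + i) k (hk.trans (hK (Nat.le_add_right _ _)))
      refine h3.trans (le_of_eq ?_)
      rw [pow_add, one_div_pow, one_div_pow]
      field_simp
  refine ⟨x, fun l r hr => ?_⟩
  obtain ⟨p, hp, hyp⟩ := hy l
  -- Serving `y l` at step `j` costs `2 * q * p`, and each later step another `2 * q`. The radius is
  -- the sum of the errors `(1 / 2) ^ j, ..., (1 / 2) ^ (j + s)`.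
  have hprop : ∀ j, ℓ j = l → ∀ s N, d (j + 1 + s) ≤ N →
      N ≤ (2 * q) ^ (s + 1) * p *
        Nat.count (fun k => dist (T^[k] (u (j + 1 + s))) (y l) ≤ (2 - (1 / 2) ^ s) * (1 / 2) ^ j) N := by
    intro j hj s
    induction s with
    | zero =>
      intro N hN
      have h := le_mul_count_of_shadow (T := T) (u := y l) (y := y l) (v := u (j + 1)) (r := 0)
        (Q := p) (by have := hM' j; omega) (hnK' j) (hdK' j) (hper' j) (by simpa only [hj] using hhit' j)
        (le_mul_count_of_dvd hp (fun k hk => by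
          obtain ⟨a, rfl⟩ := hk
          rw [Function.iterate_mul, Function.iterate_fixed hyp, dist_self]) _) N hN
      norm_num at h ⊢
      exact h
    | succ s ih =>
      intro N hN
      have h := le_mul_count_of_shadow (T := T) (u := u (j + 1 + s)) (y := y l)
        (v := u (j + 1 + s + 1)) (r := (2 - (1 / 2) ^ s) * (1 / 2) ^ j) (n := 0)
        (Q := (2 * q) ^ (s + 1) * p) (by have := hM' (j + 1 + s); omega)
        (by have := hnK' (j + 1 + s); omega) (hdK' (j + 1 + s)) (hper' (j + 1 + s))
        (by simpa only [zero_add] using hsh' (j + 1 + s))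
        (ih _ (by have := hM' (j + 1 + s); omega)) N hN
      have e1 : (2 - (1 / 2 : ℝ) ^ s) * (1 / 2) ^ j + (1 / 2) ^ (j + 1 + s) =
          (2 - (1 / 2) ^ (s + 1)) * (1 / 2) ^ j := by ring
      have e2 : 2 * q * ((2 * q) ^ (s + 1) * p) = (2 * q) ^ (s + 1 + 1) * p := by ring
      rw [e1, e2] at h
      exact h
  -- Two errors of `2 * (1 / 2) ^ J₀` must fit in `r`: from `y l` to `u j`, and from `u j` to `x`.
  obtain ⟨J₀, hJ₀⟩ := exists_pow_lt_of_lt_one (show 0 < r / 4 by positivity)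
    (show (1 / 2 : ℝ) < 1 by norm_num)
  obtain ⟨G, hG⟩ : ∃ G, 2 ^ (l + 2) = G := ⟨_, rfl⟩
  set Q := (2 * q) ^ (G + 1) * p
  have hQ : 0 < Q := by positivity
  have hu : ∀ j, J₀ + G + 1 ≤ j → ∀ N, d j ≤ N →
      N ≤ Q * Nat.count (fun k => dist (T^[k] (u j)) (y l) ≤ 2 * (1 / 2) ^ J₀) N := by
    intro j hj N hN
    -- The target was served at one of the `G + 1` steps before `j`, so `s ≤ G` and `Q` does not
    -- depend on `j`.
    obtain ⟨j', h1, h2, h3⟩ := exists_padicValNat_two_eq l (j - G - 1)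
    rw [hG] at h2
    obtain ⟨s, rfl⟩ := Nat.exists_eq_add_of_le (show j' + 1 ≤ j by omega)
    refine (hprop j' h3 s N hN).trans ?_
    refine Nat.mul_le_mul (Nat.mul_le_mul_right _ (Nat.pow_le_pow_right (by omega) (by omega))) ?_
    rw [Nat.count_eq_card_filter_range, Nat.count_eq_card_filter_range]
    refine Finset.card_le_card (Finset.monotone_filter_right _ fun k _ hk => hk.trans ?_)
    have h4 : (1 / 2 : ℝ) ^ j' ≤ (1 / 2) ^ J₀ :=
      pow_le_pow_of_le_one (by norm_num) (by norm_num) (by omega)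
    exact mul_le_mul (by linarith [hε s]) h4 (hε _).le (by norm_num)
  refine ⟨q * Q, by positivity, ?_⟩
  filter_upwards [eventually_ge_atTop (d (J₀ + G + 1))] with N hN A hA
  have hex : ∃ j, N < d j := ⟨N + 1, (Nat.lt_succ_self N).trans_le (hd.id_le _)⟩
  have hlt := Nat.find_spec hex
  have hpos : J₀ + G + 1 < Nat.find hex := hd.lt_iff_lt.1 (hN.trans_lt hlt)
  obtain ⟨j, hj⟩ : ∃ j, Nat.find hex = j + 1 := ⟨Nat.find hex - 1, by omega⟩
  have hle : d j ≤ N := by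
    exact not_lt.1 (Nat.find_min hex (hj ▸ Nat.lt_succ_self j))
  rw [hj] at hlt hpos
  have hcount : ∀ N', N' ≤ K j → N' ≤ N →
      Nat.count (fun k => dist (T^[k] (u j)) (y l) ≤ 2 * (1 / 2) ^ J₀) N' ≤
        (A ∩ Set.Iio N).ncard := by
    intro N' hN' hN''
    rw [Nat.count_eq_card_filter_range, ← Set.ncard_coe_finset]
    refine Set.ncard_le_ncard ?_ ((Set.finite_Iio N).inter_of_right A)
    intro k hk
    simp only [Finset.coe_filter, Finset.mem_range, Set.mem_ofPred_eq] at hk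
    refine ⟨hA k ?_, hk.1.trans_le hN''⟩
    have h1 := hxu j k (hk.1.le.trans hN')
    have h2 := dist_triangle (T^[k] x) (T^[k] (u j)) (y l)
    have h4 : (1 / 2 : ℝ) ^ j ≤ (1 / 2) ^ J₀ :=
      pow_le_pow_of_le_one (by norm_num) (by norm_num) (by omega)
    linarith [hk.2]
  -- The point `x` is known to follow `u j` only up to `K j`. Beyond that, `N < d (j + 1) ≤ q * K
  -- j`, so counting up to `K j` loses a factor `q`.
  rcases le_total N (K j) with h | h
  · calc N ≤ 1 * (Q * _) := by rw [one_mul]; exact hu j (by omega) N hle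
      _ ≤ q * (Q * (A ∩ Set.Iio N).ncard) := by gcongr; exacts [hq, hcount N h le_rfl]
      _ = _ := by ring
  · calc N ≤ d (j + 1) := hlt.le
      _ ≤ q * K j := hdK' j
      _ ≤ q * (Q * _) := Nat.mul_le_mul_left _ (hu j (by omega) (K j) (by have := hM' j; omega))
      _ ≤ q * (Q * (A ∩ Set.Iio N).ncard) := by gcongr; exact hcount _ le_rfl h
      _ = _ := by ring

/-- Discarding time 0 loses at most one visit, which halving the bound `1 / Q` absorbs. -/
theorem lowerDensity_pos {A : Set ℕ} {Q : ℕ} (hQ : 0 < Q)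
    (h : ∀ᶠ N in atTop, N ≤ Q * (A ∩ Set.Iio N).ncard) : 0 < lowerDensity A := by
  have hQ' : (0 : ℝ) < Q := by exact_mod_cast hQ
  refine lt_of_lt_of_le (show (0 : ℝ) < 1 / (2 * Q) by positivity) ?_
  have hcard : ∀ N : ℕ, (A ∩ Set.Icc 1 N).ncard ≤ N := fun N => by
    calc (A ∩ Set.Icc 1 N).ncard ≤ (Set.Icc 1 N).ncard :=
          Set.ncard_le_ncard Set.inter_subset_right (Set.finite_Icc 1 N)
      _ = N := by rw [← Finset.coe_Icc, Set.ncard_coe_finset, Nat.card_Icc]; omega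
  refine le_liminf_of_le ?_ ?_
  · refine IsBoundedUnder.isCoboundedUnder_ge ⟨1, ?_⟩
    refine eventually_map.2 (Eventually.of_forall fun N => ?_)
    have : ((A ∩ Set.Icc 1 N).ncard : ℝ) ≤ N := by exact_mod_cast hcard N
    exact div_le_one_of_le₀ this (Nat.cast_nonneg N)
  · filter_upwards [h, eventually_ge_atTop (2 * Q)] with N hN hN'
    have h1 : (A ∩ Set.Iio N).ncard ≤ (A ∩ Set.Icc 1 N).ncard + 1 := by
      calc (A ∩ Set.Iio N).ncard ≤ (insert 0 (A ∩ Set.Icc 1 N)).ncard := by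
            refine Set.ncard_le_ncard ?_ (((Set.finite_Icc 1 N).inter_of_right A).insert 0)
            rintro k ⟨hk, hk'⟩
            rw [Set.mem_Iio] at hk'
            rcases Nat.eq_zero_or_pos k with h0 | h0
            · exact Or.inl h0
            · exact Or.inr ⟨hk, h0, hk'.le⟩
        _ ≤ _ := Set.ncard_insert_le _ _
    have h2 : (N : ℝ) ≤ Q * (((A ∩ Set.Icc 1 N).ncard : ℝ) + 1) := by
      exact_mod_cast hN.trans (Nat.mul_le_mul_left Q h1)
    have h3 : (2 * Q : ℝ) ≤ N := by exact_mod_cast hN'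
    rw [div_le_div_iff₀ (by positivity) (by linarith)]
    linarith

/-! ### Domination of measures and composition operators -/

theorem MeasureTheory.Measure.le_of_forall_singleton_le {α : Type*} [MeasurableSpace α]
    [Countable α] [MeasurableSingletonClass α] {μ ν : Measure α} (h : ∀ x, ν {x} ≤ μ {x}) :
    ν ≤ μ := by
  refine Measure.le_iff.2 fun s hs => ?_
  rw [← Measure.tsum_indicator_apply_singleton ν s hs,
    ← Measure.tsum_indicator_apply_singleton μ s hs]
  exact ENNReal.tsum_le_tsum fun x => Set.indicator_le_indicator (h x)

/-- The algebra is dense for `μ + ν`, so one approximating set serves both measures. -/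
theorem MeasureTheory.Measure.le_smul_of_forall_mem_isSetAlgebra {α : Type*} [mα : MeasurableSpace α]
    {μ ν : Measure α} [IsFiniteMeasure μ] [IsFiniteMeasure ν] {𝒜 : Set (Set α)}
    (h𝒜 : IsSetAlgebra 𝒜) (hgen : mα = MeasurableSpace.generateFrom 𝒜) {C : ENNReal} (hC : C ≠ ⊤)
    (h : ∀ t ∈ 𝒜, ν t ≤ C * μ t) : ν ≤ C • μ := by
  refine Measure.le_iff.2 fun s hs => ?_
  rw [Measure.smul_apply, smul_eq_mul]
  have hdense := Measure.MeasureDense.of_generateFrom_isSetAlgebra_finite (μ + ν) h𝒜 hgen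
  refine ENNReal.le_of_forall_pos_le_add fun ε hε _ => ?_
  set δ : ℝ := ε / (C.toReal + 1)
  have hC0 : 0 ≤ C.toReal := ENNReal.toReal_nonneg
  have hδ : 0 < δ := by positivity
  obtain ⟨t, ht, hst⟩ := hdense.approx s hs (measure_ne_top _ _) δ hδ
  have hμst : μ (t \ s) ≤ ENNReal.ofReal δ :=
    ((measure_mono Set.subset_union_right).trans (Measure.le_add_right le_rfl _)).trans hst.le
  have hνst : ν (s \ t) ≤ ENNReal.ofReal δ :=
    ((measure_mono Set.subset_union_left).trans (Measure.le_add_left le_rfl _)).trans hst.le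
  have hsub : ∀ (ρ : Measure α) (a b : Set α), ρ a ≤ ρ b + ρ (a \ b) := fun ρ a b =>
    (measure_mono (by rw [Set.union_sdiff_self]; exact Set.subset_union_right)).trans
      (measure_union_le b (a \ b))
  calc ν s ≤ ν t + ν (s \ t) := hsub ν s t
    _ ≤ C * (μ s + μ (t \ s)) + ν (s \ t) := by
        gcongr
        exact (h t ht).trans (by gcongr; exact hsub μ t s)
    _ ≤ C * (μ s + ENNReal.ofReal δ) + ENNReal.ofReal δ := by gcongr
    _ = C * μ s + (C + 1) * ENNReal.ofReal δ := by ring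
    _ = C * μ s + ε := by
        congr 1
        rw [← ENNReal.ofReal_toReal hC, ← ENNReal.ofReal_one, ← ENNReal.ofReal_add hC0 zero_le_one,
          ← ENNReal.ofReal_mul (by positivity), mul_div_cancel₀ _ (by positivity),
          ENNReal.ofReal_coe_nnreal]

theorem exists_isCompositionOperator {Ω : Type*} [MeasurableSpace Ω] {φ : Ω → Ω} {μ : Measure Ω}
    {p : ENNReal} [Fact (1 ≤ p)] (hp : p ≠ ⊤) (hφ : Measurable φ) {C : ENNReal} (hC : C ≠ ⊤)
    (h : μ.map φ ≤ C • μ) : ∃ T : Lp ℂ p μ →L[ℂ] Lp ℂ p μ, IsCompositionOperator φ μ p T := by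
  have hq : Measure.QuasiMeasurePreserving φ μ μ :=
    ⟨hφ, (Measure.absolutelyContinuous_of_le h).trans (Measure.smul_absolutelyContinuous)⟩
  have hmem : ∀ f : Lp ℂ p μ, MemLp (f ∘ φ) p μ := fun f =>
    ((Lp.memLp f).of_measure_le_smul hC h).comp_of_map hφ.aemeasurable
  let L : Lp ℂ p μ →ₗ[ℂ] Lp ℂ p μ :=
    { toFun := fun f => (hmem f).toLp
      map_add' := fun f g => by
        rw [← MemLp.toLp_add, MemLp.toLp_eq_toLp_iff]
        exact hq.ae_eq_comp (Lp.coeFn_add f g)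
      map_smul' := fun c f => by
        rw [RingHom.id_apply, ← MemLp.toLp_const_smul, MemLp.toLp_eq_toLp_iff]
        exact hq.ae_eq_comp (Lp.coeFn_smul c f) }
  refine ⟨L.mkContinuous (C ^ (1 / p).toReal).toReal fun f => ?_, hq, fun f => (hmem f).coeFn_toLp⟩
  change ‖(hmem f).toLp‖ ≤ _
  rw [Lp.norm_toLp, Lp.norm_def, ← ENNReal.toReal_mul]
  have hC' : C ^ (1 / p).toReal ≠ ⊤ := ENNReal.rpow_ne_top_of_nonneg ENNReal.toReal_nonneg hC
  refine ENNReal.toReal_mono (ENNReal.mul_ne_top hC' (Lp.eLpNorm_ne_top f)) ?_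
  rw [← eLpNorm_map_measure (((Lp.memLp f).of_measure_le_smul hC h).aestronglyMeasurable)
    hφ.aemeasurable, ← smul_eq_mul, ← eLpNorm_smul_measure_of_ne_top hp]
  exact eLpNorm_mono_measure _ h

theorem IsCompositionOperator.iterate_ae_eq {Ω : Type*} [MeasurableSpace Ω] {φ : Ω → Ω}
    {μ : Measure Ω} {p : ENNReal} [Fact (1 ≤ p)] {T : Lp ℂ p μ →L[ℂ] Lp ℂ p μ}
    (hT : IsCompositionOperator φ μ p T) {f : Lp ℂ p μ} {g : Ω → ℂ} (hfg : f =ᵐ[μ] g) (k : ℕ) :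
    ⇑(T^[k] f) =ᵐ[μ] g ∘ φ^[k] := by
  induction k generalizing f g with
  | zero => exact hfg
  | succ k ih =>
    rw [Function.iterate_succ_apply, Function.iterate_succ']
    exact ih ((hT.apply_ae_eq f).trans (hT.nonsingular.ae_eq_comp hfg))

theorem MeasureTheory.Lp.dist_le_of_ae_eq {Ω : Type*} [MeasurableSpace Ω] {μ : Measure Ω}
    [IsFiniteMeasure μ] {p : ENNReal} [hp1 : Fact (1 ≤ p)] (hp : p ≠ ⊤) {f f' : Lp ℂ p μ}
    {g g' : Ω → ℂ} (hf : f =ᵐ[μ] g) (hf' : f' =ᵐ[μ] g') {E : Set Ω} (hE : MeasurableSet E) {c : ℝ}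
    (hc : 0 ≤ c) (h : ∀ x ∈ E, dist (g x) (g' x) ≤ c) (h' : ∀ x ∉ E, g x = g' x) :
    dist f f' ≤ c * μ.real E ^ (1 / p.toReal) := by
  have hp0 : p ≠ 0 := (zero_lt_one.trans_le hp1.out).ne'
  rw [dist_eq_norm_sub]
  calc ‖f - f'‖ ≤ ‖indicatorConstLp p hE (measure_ne_top μ E) c‖ := by
        refine Lp.norm_le_norm_of_ae_le ?_
        filter_upwards [hf, hf', Lp.coeFn_sub f f',
          indicatorConstLp_coeFn (p := p) (hs := hE) (hμs := measure_ne_top μ E) (c := c)]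
          with x h1 h2 h3 h4
        rw [h3, h4, Pi.sub_apply, h1, h2]
        by_cases hx : x ∈ E
        · rw [Set.indicator_of_mem hx, ← dist_eq_norm_sub, Real.norm_of_nonneg hc]
          exact h x hx
        · simp [h' x hx]
    _ = _ := by
        rw [norm_indicatorConstLp hp0 hp, Real.norm_of_nonneg hc]

/-! ### Shift ratios on one cyclic factor -/

section Coordinate

variable {m : ℕ}

theorem translateSub_eq_preimage (D : Set (ZMod m)) (k : ℕ) :
    translateSub D k = (fun x => x + (k : ZMod m)) ⁻¹' D := by
  ext x
  simp only [translateSub, Set.mem_image, Set.mem_preimage]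
  constructor
  · rintro ⟨y, hy, rfl⟩
    simpa using hy
  · intro hx
    exact ⟨_, hx, by simp⟩

variable [NeZero m] {μ : Measure (ZMod m)} [IsProbabilityMeasure μ]

theorem measureReal_le_maxShiftRatio_mul (hpos : ∀ j, 0 < μ {j}) (j : ZMod m) :
    μ.real {j - 1} ≤ maxShiftRatio μ * μ.real {j} := by
  have h1 : 0 < μ.real {j} := ENNReal.toReal_pos (hpos j).ne' (measure_ne_top _ _)
  rw [← div_le_iff₀ h1]
  exact le_ciSup (f := fun j => μ.real {j - 1} / μ.real {j}) (Set.finite_range _).bddAbove j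

/-- Both `μ {j - 1}` and `μ {j}` sum to 1 over `j`, so the ratios cannot all be below 1. -/
theorem one_le_maxShiftRatio (hpos : ∀ j, 0 < μ {j}) : 1 ≤ maxShiftRatio μ := by
  have h1 : ∑ j : ZMod m, μ.real {j - 1} = ∑ j : ZMod m, μ.real {j} :=
    Equiv.sum_comp (Equiv.subRight (1 : ZMod m)) fun j => μ.real {j}
  have h2 : ∑ j : ZMod m, μ.real {j} ≤ maxShiftRatio μ * ∑ j : ZMod m, μ.real {j} := by
    rw [Finset.mul_sum]
    exact h1.symm.trans_le (Finset.sum_le_sum fun j _ => measureReal_le_maxShiftRatio_mul hpos j)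
  have h3 : 0 < ∑ j : ZMod m, μ.real {j} :=
    Finset.sum_pos (fun j _ => ENNReal.toReal_pos (hpos j).ne' (measure_ne_top _ _))
      Finset.univ_nonempty
  exact le_of_mul_le_mul_right (by simpa using h2) h3

theorem measure_sub_one_le (hpos : ∀ j, 0 < μ {j}) (j : ZMod m) :
    μ {j - 1} ≤ ENNReal.ofReal (maxShiftRatio μ) * μ {j} := by
  rw [← ofReal_measureReal, ← ofReal_measureReal, ← ENNReal.ofReal_mul]
  · exact ENNReal.ofReal_le_ofReal (measureReal_le_maxShiftRatio_mul hpos j)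
  · linarith [one_le_maxShiftRatio hpos]

theorem map_add_one_le (hpos : ∀ j, 0 < μ {j}) :
    μ.map (· + 1) ≤ ENNReal.ofReal (maxShiftRatio μ) • μ := by
  refine Measure.le_of_forall_singleton_le fun j => ?_
  rw [Measure.map_apply .of_discrete (measurableSet_singleton j), Measure.smul_apply, smul_eq_mul]
  convert measure_sub_one_le hpos j using 2
  ext x
  rw [Set.mem_preimage, Set.mem_singleton_iff, Set.mem_singleton_iff, eq_sub_iff_add_eq]

theorem measureReal_translateSub_le (hpos : ∀ j, 0 < μ {j}) (D : Set (ZMod m)) (n : ℕ) :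
    μ.real (translateSub D n) ≤ maxShiftRatio μ ^ n * μ.real D := by
  have h0 := one_le_maxShiftRatio hpos
  induction n with
  | zero => simp [translateSub]
  | succ n ih =>
    have h1 : translateSub D (n + 1) = (· + 1) ⁻¹' translateSub D n := by
      ext x
      simp only [translateSub_eq_preimage, Set.mem_preimage]
      push_cast
      rw [add_assoc, add_comm (1 : ZMod m)]
    have h2 := map_add_one_le hpos (translateSub D n)
    rw [Measure.map_apply .of_discrete .of_discrete, ← h1, Measure.smul_apply, smul_eq_mul] at h2
    have h3 := ENNReal.toReal_mono (ENNReal.mul_ne_top ENNReal.ofReal_ne_top (measure_ne_top _ _)) h2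
    rw [ENNReal.toReal_mul, ENNReal.toReal_ofReal (by linarith)] at h3
    calc μ.real (translateSub D (n + 1)) ≤ maxShiftRatio μ * μ.real (translateSub D n) := h3
      _ ≤ maxShiftRatio μ * (maxShiftRatio μ ^ n * μ.real D) := by gcongr
      _ = _ := by ring

end Coordinate

/-! ### Iterates of the diagonal translation -/

theorem measurable_diagonalTranslation (m : ℕ → ℕ) : Measurable (diagonalTranslation m) :=
  measurable_pi_lambda _ fun i => (Measurable.of_discrete (f := (· + 1))).comp (measurable_pi_apply i)

theorem diagonalTranslation_iterate_apply (m : ℕ → ℕ) (k : ℕ) (x : ∀ i, ZMod (m i)) (i : ℕ) :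
    (diagonalTranslation m)^[k] x i = x i + k := by
  induction k with
  | zero => simp
  | succ k ih =>
    rw [Function.iterate_succ_apply', diagonalTranslation, ih]
    push_cast
    ring

theorem DependsOn.comp_diagonalTranslation_iterate {m : ℕ → ℕ} {i : ℕ} {β : Type*} {g : (∀ i, ZMod (m i)) → β}
    (hg : DependsOn g (Set.Iio i)) (k : ℕ) :
    DependsOn (g ∘ (diagonalTranslation m)^[k]) (Set.Iio i) := by
  intro x y h
  refine hg fun j hj => ?_
  rw [diagonalTranslation_iterate_apply, diagonalTranslation_iterate_apply, h j hj]

theorem DependsOn.comp_iterate_eq_self {m : ℕ → ℕ} {i d : ℕ} {β : Type*} {g : (∀ i, ZMod (m i)) → β}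
    (hg : DependsOn g (Set.Iio i)) (hd : ∀ j < i, m j ∣ d) (x : ∀ i, ZMod (m i)) :
    g ((diagonalTranslation m)^[d] x) = g x := by
  refine hg fun j hj => ?_
  rw [diagonalTranslation_iterate_apply, (ZMod.natCast_eq_zero_iff d (m j)).2 (hd j hj), add_zero]

/-! ### The product measure and cylinder functions -/

section Product

variable {m : ℕ → ℕ} {μ : (i : ℕ) → Measure (ZMod (m i))} [∀ i, IsProbabilityMeasure (μ i)]

theorem infinitePi_real_preimage_eval (i : ℕ) (D : Set (ZMod (m i))) :
    (Measure.infinitePi μ).real ((fun x => x i) ⁻¹' D) = (μ i).real D := by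
  rw [measureReal_def, measureReal_def, ← Measure.infinitePi_map_eval μ i,
    Measure.map_apply (measurable_pi_apply i) .of_discrete]

variable (μ) in
/-- The classes of functions that depend on finitely many coordinates. -/
def cylinderClasses (p : ENNReal) : Set (Lp ℂ p (Measure.infinitePi μ)) :=
  {f | ∃ g : (∀ i, ZMod (m i)) → ℂ, ∃ i, DependsOn g (Set.Iio i) ∧ f =ᵐ[Measure.infinitePi μ] g}

theorem dense_cylinderClasses {p : ENNReal} [hp1 : Fact (1 ≤ p)] (hp : p ≠ ⊤) :
    Dense (cylinderClasses μ p) := by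
  have : Fact (p ≠ ⊤) := ⟨hp⟩
  have hdense : (Measure.infinitePi μ).MeasureDense
      (measurableCylinders fun i => ZMod (m i)) :=
    Measure.MeasureDense.of_generateFrom_isSetAlgebra_finite _ isSetAlgebra_measurableCylinders
      generateFrom_measurableCylinders.symm
  intro f
  refine Lp.induction hp (motive := fun f => f ∈ closure (cylinderClasses μ p)) ?_ ?_
    isClosed_closure f
  · intro c s hs hμs
    rw [Lp.simpleFunc.coe_indicatorConst]
    refine closure_mono ?_
      (hdense.indicatorConstLp_subset_closure p c ⟨s, hs, hμs.ne, rfl⟩)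
    rintro _ ⟨t, ht, hμt, rfl⟩
    refine ⟨t.indicator fun _ => c, ?_⟩
    obtain ⟨J, A, -, rfl⟩ := (mem_measurableCylinders t).1 ht
    obtain ⟨N, hN⟩ := J.exists_nat_subset_range
    refine ⟨N, fun x y hxy => ?_, indicatorConstLp_coeFn⟩
    have : J.restrict x = J.restrict y :=
      funext fun j => hxy j (Finset.mem_range.1 (hN j.2))
    by_cases hx : x ∈ cylinder J A
    · have hy : y ∈ cylinder J A := by
        rw [mem_cylinder] at hx ⊢; rwa [← this]
      rw [Set.indicator_of_mem hx, Set.indicator_of_mem hy]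
    · have hy : y ∉ cylinder J A := by
        rw [mem_cylinder] at hx ⊢; rwa [← this]
      rw [Set.indicator_of_notMem hx, Set.indicator_of_notMem hy]
  · rintro f g hf hg - hf' hg'
    refine map_mem_closure₂ continuous_add hf' hg' ?_
    rintro a ⟨g, i, hg, hag⟩ b ⟨g', i', hg', hbg'⟩
    refine ⟨g + g', max i i', fun x y hxy => ?_, (Lp.coeFn_add a b).trans (hag.add hbg')⟩
    exact congr_arg₂ (· + ·) (hg fun j hj => hxy j (Set.mem_Iio.2 (lt_max_of_lt_left hj)))
      (hg' fun j hj => hxy j (Set.mem_Iio.2 (lt_max_of_lt_right hj)))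

variable [∀ i, NeZero (m i)]

/-- A finite product is discrete, so atoms suffice; there the ratio is at most the product of the
coordinate ratios. Factors being at least 1, any finite set of coordinates may be enlarged to an
initial segment. -/
theorem map_diagonalTranslation_le (hpos : ∀ (i : ℕ) (j : ZMod (m i)), 0 < μ i {j}) {K : ℝ}
    (hK : ∀ N : ℕ, ∏ i ∈ Finset.range N, maxShiftRatio (μ i) ≤ K) :
    (Measure.infinitePi μ).map (diagonalTranslation m) ≤
      ENNReal.ofReal K • Measure.infinitePi μ := by
  have hprod : ∀ s : Finset ℕ, ∏ i ∈ s, ENNReal.ofReal (maxShiftRatio (μ i)) ≤ ENNReal.ofReal K := by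
    intro s
    obtain ⟨N, hN⟩ := s.exists_nat_subset_range
    calc _ ≤ ∏ i ∈ Finset.range N, ENNReal.ofReal (maxShiftRatio (μ i)) :=
          Finset.prod_le_prod_of_subset_of_one_le' hN fun i _ _ => by
            simpa using one_le_maxShiftRatio (hpos i)
      _ = ENNReal.ofReal (∏ i ∈ Finset.range N, maxShiftRatio (μ i)) := by
          rw [ENNReal.ofReal_prod_of_nonneg]
          exact fun i _ => zero_le_one.trans (one_le_maxShiftRatio (hpos i))
      _ ≤ _ := ENNReal.ofReal_le_ofReal (hK N)
  have hfin : ∀ s : Finset ℕ, (Measure.pi fun i : s => μ i).map (fun x i => x i + 1) ≤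
      ENNReal.ofReal K • Measure.pi fun i : s => μ i := by
    intro s
    refine Measure.le_of_forall_singleton_le fun x => ?_
    rw [Measure.map_apply .of_discrete (measurableSet_singleton x), Measure.smul_apply, smul_eq_mul]
    have h1 : (fun (x : ∀ i : s, ZMod (m i)) i => x i + 1) ⁻¹' {x} = {fun i => x i - 1} := by
      ext y
      simp [funext_iff, eq_sub_iff_add_eq]
    rw [h1, Measure.pi_singleton, Measure.pi_singleton]
    calc _ ≤ ∏ i : s, (ENNReal.ofReal (maxShiftRatio (μ i)) * μ i {x i}) :=
          Finset.prod_le_prod' fun i _ => measure_sub_one_le (hpos i) (x i)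
      _ = (∏ i ∈ s, ENNReal.ofReal (maxShiftRatio (μ i))) * ∏ i : s, μ i {x i} := by
          rw [Finset.prod_mul_distrib, Finset.prod_coe_sort s fun i =>
            ENNReal.ofReal (maxShiftRatio (μ i))]
      _ ≤ _ := by gcongr; exact hprod s
  have : IsFiniteMeasure ((Measure.infinitePi μ).map (diagonalTranslation m)) :=
    Measure.isFiniteMeasure_map _ _
  refine Measure.le_smul_of_forall_mem_isSetAlgebra isSetAlgebra_measurableCylinders
    generateFrom_measurableCylinders.symm ENNReal.ofReal_ne_top fun t ht => ?_
  obtain ⟨s, A, hA, rfl⟩ := (mem_measurableCylinders t).1 ht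
  rw [Measure.map_apply (measurable_diagonalTranslation m) (.cylinder s hA)]
  have h1 : diagonalTranslation m ⁻¹' cylinder s A =
      cylinder s ((fun (x : ∀ i : s, ZMod (m i)) i => x i + 1) ⁻¹' A) := rfl
  rw [h1, Measure.infinitePi_cylinder μ .of_discrete, Measure.infinitePi_cylinder μ hA,
    ← Measure.map_apply .of_discrete hA]
  exact hfin s A

theorem DependsOn.finite_range_of_Iio {i : ℕ} {g : (∀ i, ZMod (m i)) → ℂ}
    (hg : DependsOn g (Set.Iio i)) : (Set.range g).Finite := by
  obtain ⟨G, rfl⟩ := dependsOn_iff_exists_comp.1 hg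
  exact (Set.finite_range G).subset (Set.range_comp_subset_range _ _)

theorem DependsOn.measurable_of_Iio {i : ℕ} {g : (∀ i, ZMod (m i)) → ℂ}
    (hg : DependsOn g (Set.Iio i)) : Measurable g := by
  obtain ⟨G, rfl⟩ := dependsOn_iff_exists_comp.1 hg
  exact Measurable.of_discrete.comp (measurable_pi_lambda _ fun j => measurable_pi_apply _)

theorem DependsOn.exists_norm_le_of_Iio {i : ℕ} {g : (∀ i, ZMod (m i)) → ℂ}
    (hg : DependsOn g (Set.Iio i)) : ∃ B : ℝ, 0 < B ∧ ∀ x, ‖g x‖ ≤ B := by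
  obtain ⟨B, hB, h⟩ := hg.finite_range_of_Iio.isBounded.exists_pos_norm_le
  exact ⟨B, hB, fun x => h _ ⟨x, rfl⟩⟩

theorem DependsOn.memLp_of_Iio {i : ℕ} {g : (∀ i, ZMod (m i)) → ℂ}
    (hg : DependsOn g (Set.Iio i)) (p : ENNReal) : MemLp g p (Measure.infinitePi μ) := by
  obtain ⟨B, -, hB⟩ := hg.exists_norm_le_of_Iio
  exact MemLp.of_bound hg.measurable_of_Iio.aestronglyMeasurable B (Eventually.of_forall hB)

end Product

/-! ### Gluing cylinder functions -/

section Main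

variable {m : ℕ → ℕ} [∀ i, NeZero (m i)] {μ : (i : ℕ) → Measure (ZMod (m i))}
  [∀ i, IsProbabilityMeasure (μ i)]

theorem maxShiftRatio_le_of_prod_le (hpos : ∀ (i : ℕ) (j : ZMod (m i)), 0 < μ i {j}) {C : ℝ}
    (hC : ∀ N : ℕ, ∏ i ∈ Finset.range N, maxShiftRatio (μ i) ≤ C) (i : ℕ) :
    maxShiftRatio (μ i) ≤ C := by
  have h := hC (i + 1)
  rw [Finset.prod_range_succ] at h
  have h1 : 1 ≤ ∏ i ∈ Finset.range i, maxShiftRatio (μ i) :=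
    Finset.one_le_prod fun i _ => one_le_maxShiftRatio (hpos i)
  have h2 := one_le_maxShiftRatio (hpos i)
  nlinarith

/-- Only `n` modulo `d i` matters, so both windows fit in the period `2 * d i`. The windows become
arbitrarily long because for bounded `d i` a bounded number of shifts would carry `D` from tiny to
almost full measure, against the bound on the ratios. -/
theorem exists_long_separation (hpos : ∀ (i : ℕ) (j : ZMod (m i)), 0 < μ i {j}) {C : ℝ}
    (hC : ∀ i, maxShiftRatio (μ i) ≤ C) {d : ℕ → ℕ} (hd_pos : ∀ i, 0 < d i)
    (hd_dvd : ∀ i, m i ∣ d i)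
    (h : ∃ κ : ℝ, 0 < κ ∧ ∀ ε : ℝ, 0 < ε → ∀ i₀ : ℕ, ∃ i : ℕ, i₀ ≤ i ∧
      ∃ (n : ℕ) (D : Set (ZMod (m i))), ∀ k : ℕ, (k : ℝ) ≤ κ * (d i : ℝ) →
        (μ i).real (translateSub D k) ≤ ε ∧ 1 - ε ≤ (μ i).real (translateSub D (n + k))) :
    ∃ q : ℕ, ∀ δ : ℝ, 0 < δ → ∀ i₀ M : ℕ, ∃ i, i₀ ≤ i ∧ ∃ (n K : ℕ) (D : Set (ZMod (m i))),
      M ≤ K ∧ n + K ≤ 2 * d i ∧ 2 * d i ≤ q * K ∧ ∀ k ≤ K,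
        (μ i).real (translateSub D k) ≤ δ ∧ 1 - δ ≤ (μ i).real (translateSub D (n + k)) := by
  obtain ⟨κ₀, hκ₀, h⟩ := h
  obtain ⟨κ, hκ, hκ1, hκκ₀⟩ : ∃ κ : ℝ, 0 < κ ∧ κ ≤ 1 ∧ κ ≤ κ₀ :=
    ⟨min κ₀ 1, lt_min hκ₀ one_pos, min_le_right _ _, min_le_left _ _⟩
  -- With `K = ⌊κ * d i⌋₊ ≥ 1` one has `K ≥ κ * d i / 2`, hence `2 * d i ≤ (4 / κ) * K`.
  refine ⟨⌈4 / κ⌉₊, fun δ hδ i₀ M => ?_⟩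
  have hC1 : 1 ≤ C := (one_le_maxShiftRatio (hpos 0)).trans (hC 0)
  set M' := ⌈(M + 1) / κ⌉₊
  have hM' : (M + 1) ≤ κ * M' := by
    have := Nat.le_ceil ((M + 1) / κ)
    rwa [div_le_iff₀' hκ] at this
  -- If `d i < M'`, then `1 - η ≤ C ^ M' * η`, which `(1 + C ^ M') * η ≤ 1 / 2` excludes.
  set η : ℝ := min δ (1 / (2 * (1 + C ^ M')))
  have hη : 0 < η := lt_min hδ (by positivity)
  obtain ⟨i, hi, n, D, hD⟩ := h η hη i₀
  have hmod : ∀ k, translateSub D (n % d i + k) = translateSub D (n + k) := by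
    intro k
    have h1 : ((n % d i : ℕ) : ZMod (m i)) = n :=
      (ZMod.natCast_eq_natCast_iff _ _ _).2 ((Nat.mod_modEq n (d i)).of_dvd (hd_dvd i))
    simp only [translateSub, Nat.cast_add, h1]
  have hlt : n % d i < d i := Nat.mod_lt _ (hd_pos i)
  have hd' : (0 : ℝ) < d i := by exact_mod_cast hd_pos i
  have hlarge : M' ≤ d i := by
    by_contra hcon
    have h1 := hD 0 (by push_cast; positivity)
    rw [← hmod, add_zero] at h1
    have h2 := measureReal_translateSub_le (hpos i) D (n % d i)
    have h3 : maxShiftRatio (μ i) ^ (n % d i) ≤ C ^ M' :=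
      (pow_le_pow_left₀ (zero_le_one.trans (one_le_maxShiftRatio (hpos i))) (hC i) _).trans
        (pow_le_pow_right₀ hC1 (by omega))
    have h4 : (μ i).real D ≤ η := by simpa [translateSub] using h1.1
    have h5 : maxShiftRatio (μ i) ^ (n % d i) * (μ i).real D ≤ C ^ M' * η := by gcongr
    have h6 : η * (2 * (1 + C ^ M')) ≤ 1 := by
      rw [← le_div_iff₀ (by positivity)]; exact min_le_right _ _
    nlinarith [h1.2]
  have hlarge' : (M' : ℝ) ≤ d i := by exact_mod_cast hlarge
  have hκd : (M + 1 : ℝ) ≤ κ * d i := hM'.trans (by gcongr)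
  have hK0 : M + 1 ≤ ⌊κ * d i⌋₊ := Nat.le_floor (by push_cast; exact hκd)
  have hKle : (⌊κ * d i⌋₊ : ℝ) ≤ κ * d i := Nat.floor_le (by positivity)
  refine ⟨i, hi, n % d i, ⌊κ * d i⌋₊, D, by omega, ?_, ?_, fun k hk => ?_⟩
  · have : (⌊κ * d i⌋₊ : ℝ) ≤ d i := hKle.trans (by nlinarith)
    have : ⌊κ * d i⌋₊ ≤ d i := by exact_mod_cast this
    omega
  · have h1 := Nat.lt_floor_add_one (κ * d i)
    have h2 : (1 : ℝ) ≤ ⌊κ * d i⌋₊ := by exact_mod_cast (by omega : 1 ≤ ⌊κ * d i⌋₊)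
    have h3 := Nat.le_ceil (4 / κ)
    have h4 : (2 * d i : ℝ) ≤ ⌈4 / κ⌉₊ * ⌊κ * d i⌋₊ := by
      calc (2 * d i : ℝ) = 2 * (κ * d i) / κ := by field_simp
        _ ≤ 2 * (2 * ⌊κ * d i⌋₊) / κ := by gcongr ?_ / κ; linarith
        _ = 4 / κ * ⌊κ * d i⌋₊ := by ring
        _ ≤ _ := by gcongr
    exact_mod_cast h4
  · have hk' : (k : ℝ) ≤ κ₀ * d i :=
      (Nat.cast_le.2 hk).trans (hKle.trans (by gcongr))
    rw [hmod]
    exact ⟨(hD k hk').1.trans (min_le_left _ _),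
      (sub_le_sub_left (min_le_left _ _) 1).trans (hD k hk').2⟩

/-- After `k` steps the glued function differs from the orbit of `u` only where `x i ∈ D - k`, and
after `n + k` steps from that of `w` only where `x i ∉ D - (n + k)`. Both sets are small and the
functions are bounded. -/
theorem exists_mem_cylinderClasses_shadow {p : ENNReal} [hp1 : Fact (1 ≤ p)] (hp : p ≠ ⊤)
    {T : Lp ℂ p (Measure.infinitePi μ) →L[ℂ] Lp ℂ p (Measure.infinitePi μ)}
    (hT : IsCompositionOperator (diagonalTranslation m) (Measure.infinitePi μ) p T)
    {d : ℕ → ℕ} (hd_pos : ∀ i, 0 < d i) (hd_dvd : ∀ i j : ℕ, j ≤ i → m j ∣ d i) {q : ℕ}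
    (h : ∀ δ : ℝ, 0 < δ → ∀ i₀ M : ℕ, ∃ i, i₀ ≤ i ∧ ∃ (n K : ℕ) (D : Set (ZMod (m i))),
      M ≤ K ∧ n + K ≤ 2 * d i ∧ 2 * d i ≤ q * K ∧ ∀ k ≤ K,
        (μ i).real (translateSub D k) ≤ δ ∧ 1 - δ ≤ (μ i).real (translateSub D (n + k)))
    {u w : Lp ℂ p (Measure.infinitePi μ)} (hu : u ∈ cylinderClasses μ p)
    (hw : w ∈ cylinderClasses μ p) {ε : ℝ} (hε : 0 < ε) (M : ℕ) :
    ∃ v ∈ cylinderClasses μ p, ∃ d K n : ℕ, M ≤ K ∧ n + K ≤ d ∧ d ≤ q * K ∧ T^[d] v = v ∧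
      (∀ k ≤ K, dist (T^[k] v) (T^[k] u) ≤ ε) ∧ ∀ k ≤ K, dist (T^[n + k] v) (T^[k] w) ≤ ε := by
  classical
  obtain ⟨g, a, hg, hug⟩ := hu
  obtain ⟨g', b, hg', hwg'⟩ := hw
  obtain ⟨B, hB, hgB⟩ := hg.exists_norm_le_of_Iio
  obtain ⟨B', hB', hgB'⟩ := hg'.exists_norm_le_of_Iio
  have hp0 : 0 < p.toReal := ENNReal.toReal_pos (zero_lt_one.trans_le hp1.out).ne' hp
  set δ : ℝ := (ε / (B + B')) ^ p.toReal
  have hδ : 0 < δ := by positivity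
  have hdist : ∀ t : ℝ, 0 ≤ t → t ≤ δ → (B + B') * t ^ (1 / p.toReal) ≤ ε := by
    intro t ht htδ
    calc (B + B') * t ^ (1 / p.toReal) ≤ (B + B') * δ ^ (1 / p.toReal) := by gcongr
      _ = ε := by
        rw [one_div, Real.rpow_rpow_inv (by positivity) hp0.ne', mul_div_cancel₀ _ (by positivity)]
  obtain ⟨i, hi, n, K, D, hMK, hnK, hdK, hD⟩ := h δ hδ (max a b) M
  set φ := diagonalTranslation m
  -- Translation by `s` undoes translation by `n` on coordinates up to `i`, since `n + s` is a
  -- multiple of `d i`.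
  set s := d i * n - n
  have hs : n + s = d i * n := Nat.add_sub_of_le (Nat.le_mul_of_pos_left n (hd_pos i))
  let gv : (∀ i, ZMod (m i)) → ℂ := fun x => if x i ∈ D then g' (φ^[s] x) else g x
  have hgv : DependsOn gv (Set.Iio (i + 1)) := by
    intro x y hxy
    have h1 : g x = g y := hg fun j hj => hxy j (by simp only [Set.mem_Iio] at hj ⊢; omega)
    have h2 : g' (φ^[s] x) = g' (φ^[s] y) := hg'.comp_diagonalTranslation_iterate s
      fun j hj => hxy j (by simp only [Set.mem_Iio] at hj ⊢; omega)
    simp only [gv, h1, h2, hxy i (Set.mem_Iio.2 (Nat.lt_succ_self i))]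
  set v := (hgv.memLp_of_Iio (μ := μ) p).toLp
  have hv : v =ᵐ[Measure.infinitePi μ] gv := MemLp.coeFn_toLp _
  have hmem : ∀ k x, φ^[k] x i ∈ D ↔ x ∈ (fun x : ∀ i, ZMod (m i) => x i) ⁻¹' translateSub D k := by
    intro k x
    rw [translateSub_eq_preimage, diagonalTranslation_iterate_apply]
    rfl
  have hE : ∀ k, MeasurableSet ((fun x : ∀ i, ZMod (m i) => x i) ⁻¹' translateSub D k) :=
    fun k => measurable_pi_apply i .of_discrete
  refine ⟨v, ⟨gv, i + 1, hgv, hv⟩, 2 * d i, K, n, hMK, hnK, hdK, ?_, fun k hk => ?_, fun k hk => ?_⟩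
  · refine Lp.ext ((hT.iterate_ae_eq hv _).trans (EventuallyEq.trans (Eventually.of_forall fun x => ?_)
      hv.symm))
    exact hgv.comp_iterate_eq_self
      (fun j hj => (hd_dvd i j (Nat.lt_succ_iff.1 hj)).mul_left 2) x
  · refine (Lp.dist_le_of_ae_eq hp (hT.iterate_ae_eq hv k) (hT.iterate_ae_eq hug k) (hE k)
      (by positivity : 0 ≤ B + B') (fun x hx => ?_) (fun x hx => ?_)).trans
      (hdist _ measureReal_nonneg ?_)
    · rw [dist_eq_norm_sub]
      simp only [Function.comp_apply, gv, if_pos ((hmem k x).2 hx)]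
      exact (norm_sub_le _ _).trans (by linarith [hgB (φ^[k] x), hgB' (φ^[s] (φ^[k] x))])
    · simp only [Function.comp_apply, gv, if_neg (mt (hmem k x).1 hx)]
    · rw [infinitePi_real_preimage_eval]
      exact (hD k hk).1
  · have hret : ∀ x, g' (φ^[s] (φ^[n + k] x)) = g' (φ^[k] x) := by
      intro x
      rw [← Function.iterate_add_apply, ← add_assoc, add_comm s n, hs, Function.iterate_add_apply]
      exact hg'.comp_iterate_eq_self
        (fun j hj => (hd_dvd i j (by omega)).mul_right n) _
    refine (Lp.dist_le_of_ae_eq hp (hT.iterate_ae_eq hv (n + k)) (hT.iterate_ae_eq hwg' k)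
      (hE (n + k)).compl (by positivity : 0 ≤ B + B') (fun x hx => ?_) (fun x hx => ?_)).trans
      (hdist _ measureReal_nonneg ?_)
    · rw [dist_eq_norm_sub]
      simp only [Function.comp_apply, gv, if_neg (mt (hmem (n + k) x).1 hx)]
      exact (norm_sub_le _ _).trans (by linarith [hgB (φ^[n + k] x), hgB' (φ^[k] x)])
    · simp only [Function.comp_apply, gv, if_pos ((hmem (n + k) x).2 (not_not.1 hx)), hret]
    · rw [probReal_compl_eq_one_sub (hE _), infinitePi_real_preimage_eval]
      linarith [(hD k hk).2]

end Main

/-- The hypothesis `hbdd` says that the infinite product of the numbers `sup_j μ_i(j-1)/μ_i(j)` is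
finite; all factors are at least `1`, so this means that the partial products are bounded. -/
theorem mainTheorem11
    (m : ℕ → ℕ) (hm : ∀ i, 2 ≤ m i)
    (μ : (i : ℕ) → Measure (ZMod (m i))) [∀ i, IsProbabilityMeasure (μ i)]
    (hpos : ∀ (i : ℕ) (j : ZMod (m i)), 0 < μ i {j})
    (hbdd : ∃ K : ℝ, ∀ N : ℕ, ∏ i ∈ Finset.range N, maxShiftRatio (μ i) ≤ K)
    (p : ENNReal) [Fact (1 ≤ p)] (hp : p ≠ ⊤)
    (d : ℕ → ℕ) (hd_pos : ∀ i, 0 < d i) (hd_mono : Monotone d)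
    (hd_dvd : ∀ i j : ℕ, j ≤ i → m j ∣ d i)
    (h : ∃ κ : ℝ, 0 < κ ∧ ∀ ε : ℝ, 0 < ε → ∀ i₀ : ℕ, ∃ i : ℕ, i₀ ≤ i ∧
      ∃ (n : ℕ) (D : Set (ZMod (m i))), ∀ k : ℕ, (k : ℝ) ≤ κ * (d i : ℝ) →
        (μ i).real (translateSub D k) ≤ ε ∧ 1 - ε ≤ (μ i).real (translateSub D (n + k))) :
    ∃ T : Lp ℂ p (Measure.infinitePi μ) →L[ℂ] Lp ℂ p (Measure.infinitePi μ),
      IsCompositionOperator (diagonalTranslation m) (Measure.infinitePi μ) p T ∧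
        IsFrequentlyHypercyclic T := by
  have (i : ℕ) : NeZero (m i) := ⟨by have := hm i; omega⟩
  have : Fact (p ≠ ⊤) := ⟨hp⟩
  obtain ⟨C, hC⟩ := hbdd
  obtain ⟨T, hT⟩ := exists_isCompositionOperator hp (measurable_diagonalTranslation m)
    ENNReal.ofReal_ne_top (map_diagonalTranslation_le hpos hC)
  refine ⟨T, hT, ?_⟩
  obtain ⟨q, hq⟩ := exists_long_separation hpos (maxShiftRatio_le_of_prod_le hpos hC) hd_pos
    (fun i => hd_dvd i i le_rfl) h
  have hdense : Dense (cylinderClasses μ p) := dense_cylinderClasses hp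
  have : Nonempty (cylinderClasses μ p) := hdense.nonempty.to_subtype
  let y : ℕ → cylinderClasses μ p := TopologicalSpace.denseSeq _
  have hy : DenseRange fun l => (y l : Lp ℂ p (Measure.infinitePi μ)) :=
    hdense.denseRange_val.comp (TopologicalSpace.denseRange_denseSeq _) continuous_subtype_val
  obtain ⟨x, hx⟩ := exists_frequently_visiting T.continuous (fun l => (y l).2) (fun l => by
      obtain ⟨g, i, hg, hgy⟩ := (y l).2
      refine ⟨d i, hd_pos i, Lp.ext ((hT.iterate_ae_eq hgy _).trans
        (EventuallyEq.trans (Eventually.of_forall fun x => ?_) hgy.symm))⟩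
      exact hg.comp_iterate_eq_self (fun j hj => hd_dvd i j hj.le) x)
    fun u hu w hw ε hε M => exists_mem_cylinderClasses_shadow hp hT hd_pos hd_dvd hq hu hw hε M
  refine ⟨x, fun V hV hV' => ?_⟩
  obtain ⟨l, hl⟩ := hy.exists_mem_open hV hV'
  obtain ⟨r, hr, hrV⟩ := Metric.isOpen_iff.1 hV _ hl
  obtain ⟨Q, hQ, hxQ⟩ := hx l r hr
  refine lowerDensity_pos hQ (hxQ.mono fun N hN => hN _ fun k hk => ?_)
  change (T ^ k) x ∈ V
  rw [FunLike.coe_pow_eq_iterate]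
  exact hrV hk
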